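/- Let $M$ be a smooth manifold of dimension $n$ with a Finsler metric $F:TM\to[0,\infty)$, i.e. $F$ is continuous, smooth on $TM\setminus 0$, positively homogeneous of degree one on each tangent space, and for all $y\in T_xM\setminus\{0\}$ the bilinear form $g_y(u,v)=\frac12\frac{\partial^2}{\partial s\,\partial t}F^2(x,y+su+tv)\big|_{s=t=0}$ is positive definite. Let $G$ be a Lie group acting smoothly and transitively on $M$ by isometries of $F$, let $p\in M$, let $H$ be the isotropy group of $p$, and let $\mathfrak g,\mathfrak h$ be the Lie algebras of $G$ and $H$. For $X\in\mathfrak g$ let $X^*_p=\frac{d}{dt}\big|_{t=0}\exp(tX)p\in T_pM$. A geodesic is a smooth curve $c$ with $F(\dot c)$ equal to a positive constant and, in local coordinates, $\ddot c^i+\Gamma^i_{jk}(c,\dot c)\dot c^j\dot c^k=0$, where $\Gamma^i_{jk}$ are the coefficients of the Chern connection of $F$. A vector $X\in\mathfrak g\setminus\{0\}$ is a geodesic vector if $\gamma(t)=\exp(tX)p$, $t\in\mathbb R$, is a geodesic. For a basis $(e_i)$ of $T_xM$ with dual basis $(\omega^i)$, the Busemann volume form at $x$ is $\sigma(x)\,\omega^1\wedge\dots\wedge\omega^n$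 with $\sigma(x)=\mathrm{Vol}(B^n)/\mathrm{Vol}\{(y^i)\in\mathbb R^n: F(x,y^ie_i)<1\}$, where $B^n$ is the unit ball of $\mathbb R^n$. The distortion is $\tau(x,y)=\ln\big(\sqrt{\det (g_y(e_i,e_j))}/\sigma(x)\big)$ for $y\in T_xM\setminus\{0\}$ (it does not depend on the basis), and the S-curvature is $\mathbf S(x,y)=\frac{d}{dt}\big|_{t=0}\tau(c(t),\dot c(t))$, where $c$ is the geodesic with $\dot c(0)=y$. **Theorem 5.1.** Let $X\in\mathfrak g$ be a geodesic vector and $\gamma(t)=\exp(tX)p$. Then: 1. for every reductive decomposition $\mathfrak g=\mathfrak m\oplus\mathfrak h$ (i.e. $\mathrm{Ad}(H)\mathfrak m\subseteq\mathfrak m$), $\mathbf S(p,X_{\mathfrak m})=0$, where $X_{\mathfrak m}$ is the $\mathfrak m$-component of $X$ and $Z\in\mathfrak m$ is identified with $Z^*_p\in T_pM$; 2. for all $t\in\mathbb R$, $\tau(\gamma(t),\dot\gamma(t))=\tau(\gamma(0),\dot\gamma(0))$ and $\mathbf S(\gamma(t),\dot\gamma(t))=0$. -/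

import Mathlib

open scoped Manifold ContDiff

noncomputable section

namespace Finsler

/-- The coordinate space `ℝⁿ`. -/
abbrev Vec (n : ℕ) : Type := EuclideanSpace ℝ (Fin n)

/-- The `k`-th standard basis vector of `ℝⁿ`. -/
def stdVec {n : ℕ} (k : Fin n) : Vec n := EuclideanSpace.single k 1

section Metric

variable {n : ℕ} {M : Type*} [TopologicalSpace M] [ChartedSpace (Vec n) M]

/-- The fundamental tensor `g_y(u, w) = ½ D²(F²|_{T_x M})(y)(u, w)`, where `v = (x, y)`. The tangent
space `T_x M` is, as a vector space, the coordinate space `ℝⁿ`. -/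
def fundamentalTensor (F : TangentBundle (𝓡 n) M → ℝ) (v : TangentBundle (𝓡 n) M)
    (u w : TangentSpace (𝓡 n) v.proj) : ℝ :=
  (1 / 2 : ℝ) * fderiv ℝ (fderiv ℝ (fun y : Vec n => F ⟨v.proj, y⟩ ^ 2)) v.snd u w

/-- The coefficient `σ(x)` of the Busemann volume form `σ(x) ω¹ ∧ … ∧ ωⁿ` with respect to the basis
`e` of `T_x M` with dual basis `ω`: the Euclidean volume of the unit ball of `ℝⁿ` divided by
that of `{(yⁱ) ∈ ℝⁿ | F(yⁱ eᵢ) < 1}`. -/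
def busemannDensity (F : TangentBundle (𝓡 n) M → ℝ) (x : M)
    (e : Module.Basis (Fin n) ℝ (TangentSpace (𝓡 n) x)) : ℝ :=
  MeasureTheory.volume.real (Metric.ball (0 : Vec n) 1) /
    MeasureTheory.volume.real {y : Vec n | F ⟨x, ∑ i, y i • e i⟩ < 1}

/-- The distortion at `v = (x, y)`, `ln (√det g_y(eᵢ, eⱼ) / σ(x))`, computed in the basis `e` of
`T_x M`, for the Busemann volume form. -/
def distortionIn (F : TangentBundle (𝓡 n) M → ℝ) (v : TangentBundle (𝓡 n) M)
    (e : Module.Basis (Fin n) ℝ (TangentSpace (𝓡 n) v.proj)) : ℝ :=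
  Real.log (Real.sqrt (Matrix.det (Matrix.of fun i j => fundamentalTensor F v (e i) (e j))) /
    busemannDensity F v.proj e)

/-- The coordinate basis of `T_x M` (for the preferred chart at `x`). -/
def coordBasis (x : M) : Module.Basis (Fin n) ℝ (TangentSpace (𝓡 n) x) :=
  (EuclideanSpace.basisFun (Fin n) ℝ).toBasis

/-- The distortion `τ : TM ∖ 0 → ℝ` for the Busemann volume form. It does not depend on the basis
used, see `distortion_eq_distortionIn`. -/
def distortion (F : TangentBundle (𝓡 n) M → ℝ) (v : TangentBundle (𝓡 n) M) : ℝ :=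
  distortionIn F v (coordBasis v.proj)

theorem sum_smul_coordBasis (x : M) (y : Vec n) :
    (∑ i, y i • coordBasis (n := n) x i : TangentSpace (𝓡 n) x) = y :=
  (EuclideanSpace.basisFun (Fin n) ℝ).toBasis.sum_repr y

/-- The distortion does not depend on the basis of `T_x M` in which it is computed. -/
theorem distortion_eq_distortionIn (F : TangentBundle (𝓡 n) M → ℝ) (v : TangentBundle (𝓡 n) M)
    (e : Module.Basis (Fin n) ℝ (TangentSpace (𝓡 n) v.proj)) :
    distortion F v = distortionIn F v e := by
  let b : Module.Basis (Fin n) ℝ (Vec n) := (EuclideanSpace.basisFun (Fin n) ℝ).toBasis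
  let e' : Module.Basis (Fin n) ℝ (Vec n) := e
  let A : Vec n ≃ₗ[ℝ] Vec n := b.equiv e' (Equiv.refl _)
  have hA : ∀ i, A (b i) = e' i := fun i => by simp [A]
  have hAy : ∀ y : Vec n, A y = ∑ i, y i • e' i := fun y => by
    conv_lhs => rw [← b.sum_repr y]
    rw [map_sum]
    refine Finset.sum_congr rfl fun i _ => ?_
    rw [map_smul, hA]
    rfl
  have hdet : LinearMap.det (A : Vec n →ₗ[ℝ] Vec n) ≠ 0 := (LinearEquiv.isUnit_det' A).ne_zero
  have hvol : MeasureTheory.volume.real {y : Vec n | F ⟨v.proj, ∑ i, y i • e i⟩ < 1} =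
      |(LinearMap.det (A : Vec n →ₗ[ℝ] Vec n))⁻¹| * MeasureTheory.volume.real
        {y : Vec n | F ⟨v.proj, ∑ i, y i • coordBasis v.proj i⟩ < 1} := by
    have h1 : {y : Vec n | F ⟨v.proj, ∑ i, y i • e i⟩ < 1} = (A : Vec n →ₗ[ℝ] Vec n) ⁻¹'
        {y : Vec n | F ⟨v.proj, ∑ i, y i • coordBasis v.proj i⟩ < 1} := by
      ext y
      simp only [Set.mem_ofPred_eq, Set.mem_preimage, sum_smul_coordBasis]
      exact iff_of_eq (congrArg (fun w : Vec n => F ⟨v.proj, w⟩ < 1) (hAy y).symm)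
    rw [h1, MeasureTheory.measureReal_def, MeasureTheory.Measure.addHaar_preimage_linearMap _ hdet,
      ENNReal.toReal_mul, ENNReal.toReal_ofReal (abs_nonneg _), MeasureTheory.measureReal_def]
  have hmat : Matrix.det (Matrix.of fun i j => fundamentalTensor F v (e i) (e j)) =
      LinearMap.det (A : Vec n →ₗ[ℝ] Vec n) ^ 2 * Matrix.det (Matrix.of fun i j =>
        fundamentalTensor F v (coordBasis v.proj i) (coordBasis v.proj j)) := by
    let P := LinearMap.toMatrix b b (A : Vec n →ₗ[ℝ] Vec n)
    have he : ∀ j, e' j = ∑ k, P k j • b k := fun j => by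
      rw [← hA, ← b.sum_repr (A (b j))]
      simp [P, LinearMap.toMatrix_apply]
    have hm : (Matrix.of fun i j => fundamentalTensor F v (e i) (e j)) =
        P.transpose * (Matrix.of fun i j =>
          fundamentalTensor F v (coordBasis v.proj i) (coordBasis v.proj j)) * P := by
      ext i j
      let D : Vec n →L[ℝ] Vec n →L[ℝ] ℝ :=
        fderiv ℝ (fderiv ℝ (fun y : Vec n => F ⟨v.proj, y⟩ ^ 2)) v.snd
      change (1 / 2 : ℝ) * D (e' i) (e' j) = _
      rw [he i, he j, Matrix.mul_apply]
      simp only [Matrix.mul_apply, Matrix.transpose_apply, Matrix.of_apply, map_sum, map_smul,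
        sum_apply, smul_apply, smul_eq_mul,
        Finset.mul_sum, Finset.sum_mul]
      refine Finset.sum_congr rfl fun k _ => Finset.sum_congr rfl fun l _ => ?_
      change (1 / 2 : ℝ) * (P k j * (P l i * D (b l) (b k))) =
        P l i * ((1 / 2 : ℝ) * D (b l) (b k)) * P k j
      ring
    rw [hm, Matrix.det_mul, Matrix.det_mul, Matrix.det_transpose, LinearMap.det_toMatrix]
    ring
  unfold distortion distortionIn busemannDensity
  rw [hvol, hmat, Real.sqrt_mul (sq_nonneg _), Real.sqrt_sq_eq_abs, abs_inv]
  have h0 : |LinearMap.det (A : Vec n →ₗ[ℝ] Vec n)| ≠ 0 := abs_ne_zero.mpr hdet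
  congr 1
  generalize |LinearMap.det (A : Vec n →ₗ[ℝ] Vec n)| = a at h0
  rw [div_div_eq_mul_div, div_div_eq_mul_div]
  congr 1
  field_simp

variable (n M) in
/-- A Finsler metric on an `n`-dimensional smooth manifold `M`. -/
structure FinslerMetric [IsManifold (𝓡 n) ∞ M] where
  /-- the function `F : TM → [0, ∞)` -/
  toFun : TangentBundle (𝓡 n) M → ℝ
  nonneg : ∀ v, 0 ≤ toFun v
  continuous : Continuous toFun
  contMDiffOn : ContMDiffOn (𝓡 n).tangent 𝓘(ℝ, ℝ) ∞ toFun {v | v.snd ≠ 0}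
  map_smul : ∀ (x : M) (y : TangentSpace (𝓡 n) x) (t : ℝ), 0 ≤ t →
    toFun ⟨x, t • y⟩ = t * toFun ⟨x, y⟩
  pos_def : ∀ v : TangentBundle (𝓡 n) M, v.snd ≠ 0 →
    ∀ u : TangentSpace (𝓡 n) v.proj, u ≠ 0 → 0 < fundamentalTensor toFun v u u

end Metric

section Chern

/-! Local formulas: `L` is a Finsler function in natural coordinates `(xⁱ, yⁱ)` of `TM`, and
`z = (x, y)`. -/

variable {n : ℕ}

/-- `∂f/∂xᵏ` -/
def dX (k : Fin n) (f : Vec n × Vec n → ℝ) (z : Vec n × Vec n) : ℝ :=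
  fderiv ℝ f z (stdVec k, 0)

/-- `∂f/∂yᵏ` -/
def dY (k : Fin n) (f : Vec n × Vec n → ℝ) (z : Vec n × Vec n) : ℝ :=
  fderiv ℝ f z (0, stdVec k)

/-- `gᵢⱼ = (½ L²)_{yⁱ yʲ}` -/
def gLow (L : Vec n × Vec n → ℝ) (i j : Fin n) : Vec n × Vec n → ℝ :=
  dY i (dY j fun z => (1 / 2 : ℝ) * L z ^ 2)

/-- the inverse matrix `gⁱʲ` -/
def gInv (L : Vec n × Vec n → ℝ) (i j : Fin n) (z : Vec n × Vec n) : ℝ :=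
  (Matrix.of fun a b => gLow L a b z)⁻¹ i j

/-- the formal Christoffel symbols
`γⁱⱼₖ = ½ gⁱˢ (∂g_{sj}/∂xᵏ - ∂g_{jk}/∂xˢ + ∂g_{ks}/∂xʲ)` -/
def formalChristoffel (L : Vec n × Vec n → ℝ) (i j k : Fin n) (z : Vec n × Vec n) : ℝ :=
  (1 / 2 : ℝ) * ∑ s, gInv L i s z *
    (dX k (gLow L s j) z - dX s (gLow L j k) z + dX j (gLow L k s) z)

/-- the Cartan tensor with first index raised, `Cⁱⱼₖ = ½ gⁱˢ ∂g_{sj}/∂yᵏ` -/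
def cartanUp (L : Vec n × Vec n → ℝ) (i j k : Fin n) (z : Vec n × Vec n) : ℝ :=
  (1 / 2 : ℝ) * ∑ s, gInv L i s z * dY k (gLow L s j) z

/-- the nonlinear connection `Nⁱⱼ = γⁱⱼₖ yᵏ - Cⁱⱼₖ γᵏᵣₛ yʳ yˢ` -/
def nonlinearConn (L : Vec n × Vec n → ℝ) (i j : Fin n) (z : Vec n × Vec n) : ℝ :=
  (∑ k, formalChristoffel L i j k z * z.2 k) -
    ∑ k, cartanUp L i j k z * ∑ r, ∑ s, formalChristoffel L k r s z * z.2 r * z.2 s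

/-- the horizontal derivative `δf/δxᵏ = ∂f/∂xᵏ - Nˢₖ ∂f/∂yˢ` -/
def dHor (L : Vec n × Vec n → ℝ) (k : Fin n) (f : Vec n × Vec n → ℝ) (z : Vec n × Vec n) : ℝ :=
  dX k f z - ∑ s, nonlinearConn L s k z * dY s f z

/-- the Chern connection coefficients
`Γⁱⱼₖ = ½ gⁱˢ (δg_{sj}/δxᵏ - δg_{jk}/δxˢ + δg_{ks}/δxʲ)` -/
def chernCoeff (L : Vec n × Vec n → ℝ) (i j k : Fin n) (z : Vec n × Vec n) : ℝ :=
  (1 / 2 : ℝ) * ∑ s, gInv L i s z *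
    (dHor L k (gLow L s j) z - dHor L s (gLow L j k) z + dHor L j (gLow L k s) z)

end Chern

section Curves

variable {n : ℕ} {M : Type*} [TopologicalSpace M] [ChartedSpace (Vec n) M]

/-- The velocity of a curve, as a point `(c t, ċ t)` of the tangent bundle. -/
def velocity (c : ℝ → M) (t : ℝ) : TangentBundle (𝓡 n) M :=
  ⟨c t, mfderiv 𝓘(ℝ, ℝ) (𝓡 n) c t (1 : ℝ)⟩

variable [IsManifold (𝓡 n) ∞ M]

/-- The Finsler function in the natural coordinates `(xⁱ, yⁱ)` of `TM` that are induced by the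
chart of `M` at `x₀`. -/
def localExpr (F : TangentBundle (𝓡 n) M → ℝ) (x₀ : M) : Vec n × Vec n → ℝ :=
  fun z => F ((extChartAt (𝓡 n).tangent (⟨x₀, 0⟩ : TangentBundle (𝓡 n) M)).symm z)

/-- `c` is a constant (nonzero) speed geodesic of `F` on the open set of times `J`: it is smooth,
`F(ċ)` is a positive constant, and in local coordinates
`c̈ⁱ + Γⁱⱼₖ(c, ċ) ċʲ ċᵏ = 0`, i.e. `D_ċ ċ = 0` with reference vector `ċ`. -/
structure IsGeodesicOn (F : TangentBundle (𝓡 n) M → ℝ) (c : ℝ → M) (J : Set ℝ) : Prop where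
  smooth : ContMDiffOn 𝓘(ℝ, ℝ) (𝓡 n) ∞ c J
  speed : ∃ κ : ℝ, 0 < κ ∧ ∀ t ∈ J, F (velocity c t) = κ
  equation : ∀ t ∈ J, ∀ x₀ : M, c t ∈ (extChartAt (𝓡 n) x₀).source → ∀ i : Fin n,
    let ξ : ℝ → Vec n := fun s => extChartAt (𝓡 n) x₀ (c s)
    deriv (deriv ξ) t i + ∑ j, ∑ k,
      deriv ξ t j * deriv ξ t k * chernCoeff (localExpr F x₀) i j k (ξ t, deriv ξ t) = 0

/-- The S-curvature (for the Busemann volume form) at the tangent vector `v` exists and equals `s`: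
there is a geodesic `c` with `ċ(0) = v`, and for each such geodesic
`d/dt τ(c(t), ċ(t))` exists and equals `s` at `t = 0`. -/
def HasSCurvature (F : TangentBundle (𝓡 n) M → ℝ) (v : TangentBundle (𝓡 n) M) (s : ℝ) : Prop :=
  (∃ (c : ℝ → M) (ε : ℝ), 0 < ε ∧ IsGeodesicOn F c (Set.Ioo (-ε) ε) ∧ velocity c 0 = v) ∧
  ∀ (c : ℝ → M) (ε : ℝ), 0 < ε → IsGeodesicOn F c (Set.Ioo (-ε) ε) → velocity c 0 = v →
    HasDerivAt (fun t => distortion F (velocity c t)) s 0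

theorem HasSCurvature.unique {F : TangentBundle (𝓡 n) M → ℝ} {v : TangentBundle (𝓡 n) M}
    {s s' : ℝ} (h : HasSCurvature F v s) (h' : HasSCurvature F v s') : s = s' := by
  obtain ⟨⟨c, ε, hε, hc, hv⟩, H⟩ := h
  exact (H c ε hε hc hv).unique (h'.2 c ε hε hc hv)

end Curves

section LieGroup

variable {d : ℕ} {G : Type*} [TopologicalSpace G] [ChartedSpace (Vec d) G] [Group G]

/-- `φ` is a smooth one-parameter subgroup of `G` with initial velocity `X`. -/
structure IsOneParameterSubgroup (φ : ℝ → G) (X : GroupLieAlgebra (𝓡 d) G) : Prop where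
  smooth : ContMDiff 𝓘(ℝ, ℝ) (𝓡 d) ∞ φ
  map_add : ∀ s t, φ (s + t) = φ s * φ t
  velocity_zero : velocity φ 0 = (⟨1, X⟩ : TangentBundle (𝓡 d) G)

open Classical in
/-- The exponential map of a Lie group: `exp X = φ(1)` for the one-parameter subgroup `φ` with
initial velocity `X` (which always exists and is unique, so the default value is irrelevant). -/
def lieExp (X : GroupLieAlgebra (𝓡 d) G) : G :=
  if h : ∃ φ : ℝ → G, IsOneParameterSubgroup φ X then h.choose 1 else 1

/-- The adjoint representation: `Ad(a)` is the derivative at the identity of `b ↦ a b a⁻¹`. -/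
def Ad (a : G) (X : GroupLieAlgebra (𝓡 d) G) : GroupLieAlgebra (𝓡 d) G :=
  (mfderiv (𝓡 d) (𝓡 d) (fun b : G => a * b * a⁻¹) 1 X : Vec d)

variable {M : Type*} [MulAction G M]

/-- `𝔤 = 𝔪 ⊕ 𝔥` is a reductive decomposition for the homogeneous space `M = G/H`, where `H` is the
isotropy group of `p`, with Lie algebra `𝔥 = {Y | exp(tY) ∈ H for all t}`, and `Ad(H)𝔪 ⊆ 𝔪`. -/
structure IsReductiveDecomposition (p : M) (m h : Submodule ℝ (GroupLieAlgebra (𝓡 d) G)) :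
    Prop where
  mem_isotropy : ∀ Y, Y ∈ h ↔ ∀ t : ℝ, lieExp (t • Y) ∈ MulAction.stabilizer G p
  isCompl : IsCompl m h
  Ad_mem : ∀ a ∈ MulAction.stabilizer G p, ∀ Y ∈ m, Ad a Y ∈ m

variable {n : ℕ} [TopologicalSpace M] [ChartedSpace (Vec n) M]

/-- `G` acts by isometries of `F`: `F(da(v)) = F(v)`. -/
def IsInvariant (G : Type*) [Group G] [MulAction G M] (F : TangentBundle (𝓡 n) M → ℝ) : Prop :=
  ∀ (a : G) (v : TangentBundle (𝓡 n) M), F (tangentMap (𝓡 n) (𝓡 n) (fun q : M => a • q) v) = F v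

/-- The value at `p` of the fundamental vector field of `X`, that is `dπ(X)` for the orbit map
`π : a ↦ a • p`, as a point of the tangent bundle of `M`. -/
def orbitTangent (p : M) (X : GroupLieAlgebra (𝓡 d) G) : TangentBundle (𝓡 n) M :=
  tangentMap (𝓡 d) (𝓡 n) (fun a : G => a • p) ⟨1, X⟩

/-- The orbit `γ(t) = exp(tX) p`. -/
def orbitCurve (p : M) (X : GroupLieAlgebra (𝓡 d) G) : ℝ → M := fun t => lieExp (t • X) • p

/-- `X` is a geodesic vector: `X ≠ 0` and `exp(tX) p` is a constant speed geodesic. -/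
def IsGeodesicVector [IsManifold (𝓡 n) ∞ M] (F : TangentBundle (𝓡 n) M → ℝ) (p : M)
    (X : GroupLieAlgebra (𝓡 d) G) : Prop :=
  X ≠ 0 ∧ IsGeodesicOn F (orbitCurve p X) Set.univ

end LieGroup

end Finsler

end

/-! The curve `γ(t) = exp(tX)p` is an orbit of a one-parameter group of isometries: `γ(s + t) =
exp(tX) γ(s)`, so the differential of `exp(tX)` carries the initial velocity to the velocity at time
`t` (`velocity_orbitCurve`). The distortion at a vector is built from the restriction of `F` to one
tangent space and does not depend on a basis, so linear isometries between tangent spaces preserve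
it (`distortion_eq_of_isometry`). Hence `τ` is constant along `γ`.

Since `γ` is itself a geodesic, its S-curvature is the derivative of a constant. `HasSCurvature`
quantifies over all geodesics with the given velocity, so local uniqueness is needed
(`FinslerMetric.geodesic_eventuallyEq`): geodesics lift to integral curves of the spray, which is
smooth off the zero section because `g_y` is invertible there.

For the reductive statement, `X - X_𝔪` lies in `𝔥`, whose one-parameter subgroups fix `p`; thus
`X_𝔪` and `X` induce the same vector at `p`, namely the initial velocity of `γ`. Computing with
`lieExp` rests on the completeness of left-invariant fields (`IsOneParameterSubgroup.lieExp_smul`).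
-/

noncomputable section

namespace Finsler

/-! ### Regularity of integral curves. -/

section IntegralCurves

open Bundle Function Set Filter
open scoped Topology

variable {E : Type*} [NormedAddCommGroup E] [NormedSpace ℝ E] [CompleteSpace E]
  {H : Type*} [TopologicalSpace H] {I : ModelWithCorners ℝ E H}
  {M : Type*} [TopologicalSpace M] [ChartedSpace H M] [IsManifold I ∞ M]

/-- Integral curves of a smooth vector field are smooth. -/
theorem contMDiff_of_isMIntegralCurve {v : (x : M) → TangentSpace I x}
    (hv : ContMDiff I I.tangent ∞ (fun x => (⟨x, v x⟩ : TangentBundle I M))) {γ : ℝ → M}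
    (hγ : IsMIntegralCurve γ v) : ContMDiff 𝓘(ℝ, ℝ) I ∞ γ := by
  intro t₀
  -- `f` is the field read in the chart at `γ t₀`; the coordinates of `γ` solve the autonomous
  -- equation `x' = f x`, whose solutions inherit the smoothness of `f`.
  set f : E → E := fun x =>
    tangentCoordChange I ((extChartAt I (γ t₀)).symm x) (γ t₀) ((extChartAt I (γ t₀)).symm x)
      (v ((extChartAt I (γ t₀)).symm x)) with hf
  have hfs : ContDiffOn ℝ ∞ f (extChartAt I (γ t₀)).target := by
    refine (((contMDiff_iff.1 hv).2 (γ t₀) ⟨γ t₀, 0⟩).mono ?_).snd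
    intro z hz
    refine ⟨hz, ?_⟩
    have := (extChartAt I (γ t₀)).map_target hz
    simp only [mem_preimage]
    rw [extChartAt_source] at this
    rw [extChartAt_source, TangentBundle.mem_chart_source_iff]
    exact this
  have hev : ∀ᶠ t in 𝓝 t₀, γ t ∈ (extChartAt I (γ t₀)).source :=
    hγ.continuous.continuousAt.eventually (extChartAt_source_mem_nhds (I := I) (γ t₀))
  obtain ⟨ε, hε, hsrc⟩ := Metric.nhds_basis_closedBall.eventually_iff.1 hev
  rw [Real.closedBall_eq_Icc] at hsrc
  have hsm : ContDiffOn ℝ ∞ (extChartAt I (γ t₀) ∘ γ) (Icc (t₀ - ε) (t₀ + ε)) := by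
    refine ODE.contDiffOn_enat_Icc_of_hasDerivWithinAt (f := fun _ => f) (n := ⊤)
      (u := (extChartAt I (γ t₀)).target) ?_ ?_ ?_
    · exact hfs.comp contDiffOn_snd fun z hz => hz.2
    · intro t ht
      have := (hγ.isMIntegralCurveOn (Icc (t₀ - ε) (t₀ + ε))).hasDerivWithinAt ht (hsrc ht)
      convert this using 1
      simp only [hf, comp_apply]
      rw [(extChartAt I (γ t₀)).left_inv (hsrc ht)]
    · intro t ht
      exact (extChartAt I (γ t₀)).map_source (hsrc ht)
  refine contMDiffAt_iff.2 ⟨hγ.continuous.continuousAt, ?_⟩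
  have := (hsm.contDiffAt (Icc_mem_nhds (sub_lt_self t₀ hε)
    (lt_add_of_pos_right t₀ hε))).contDiffWithinAt (s := univ)
  simpa using! this

end IntegralCurves

/-! ### One-parameter subgroups and the exponential map. -/

section OneParameterSubgroups

open Bundle Function Set Filter
open scoped Topology

variable {d : ℕ} {G : Type*} [TopologicalSpace G] [ChartedSpace (Vec d) G] [Group G]
    [LieGroup (𝓡 d) ∞ G]

/-- Left-invariant vector fields on a smooth Lie group are smooth. -/
theorem contMDiff_mulInvariantVectorField_infty (X : GroupLieAlgebra (𝓡 d) G) :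
    ContMDiff (𝓡 d) (𝓡 d).tangent ∞
      (fun g : G => (⟨g, mulInvariantVectorField X g⟩ : TangentBundle (𝓡 d) G)) := by
  -- The field at `g` is the differential of the multiplication at `(g, 1)` applied to `(0, X)`, a
  -- composite of smooth maps.
  let fg : G → TangentBundle (𝓡 d) G := fun g ↦ TotalSpace.mk' (Vec d) g 0
  have sfg : ContMDiff (𝓡 d) (𝓡 d).tangent ∞ fg := contMDiff_zeroSection _ _
  let fv : G → TangentBundle (𝓡 d) G := fun _ ↦ TotalSpace.mk' (Vec d) 1 X
  have sfv : ContMDiff (𝓡 d) (𝓡 d).tangent ∞ fv := contMDiff_const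
  have S₂ : ContMDiff ((𝓡 d).tangent.prod (𝓡 d).tangent) ((𝓡 d).prod (𝓡 d)).tangent ∞
    (equivTangentBundleProd (𝓡 d) G (𝓡 d) G).symm := contMDiff_equivTangentBundleProd_symm
  have S₃ : ContMDiff ((𝓡 d).prod (𝓡 d)).tangent (𝓡 d).tangent ∞
      (tangentMap ((𝓡 d).prod (𝓡 d)) (𝓡 d) (fun p : G × G ↦ p.1 * p.2)) :=
    (contMDiff_mul (𝓡 d) ∞).contMDiff_tangentMap (m := ∞) le_rfl
  let S := (S₃.comp S₂).comp (sfg.prodMk sfv)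
  convert! S with g
  · simp [fg, fv]
  · simp only [comp_apply, tangentMap, fg, fv]
    rw [mfderiv_prod_eq_add_apply
      ((contMDiff_mul (𝓡 d) ∞).mdifferentiable (by simp)).mdifferentiableAt]
    let R : Vec d →L[ℝ] Vec d := mfderiv (𝓡 d) (𝓡 d) (fun z : G => z * 1) g
    let Y : Vec d := mulInvariantVectorField X g
    change Y = R 0 + Y
    rw [map_zero, zero_add]

theorem mdifferentiableAt_mul_left (a g : G) :
    MDifferentiableAt (𝓡 d) (𝓡 d) (a * ·) g :=
  (contMDiff_mul_left (I := 𝓡 d) (n := ∞) (a := a)).mdifferentiable (by simp) g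

omit [LieGroup (𝓡 d) ∞ G] in
theorem mulInvariantVectorField_one (X : GroupLieAlgebra (𝓡 d) G) :
    mulInvariantVectorField X (1 : G) = X := by
  have h : ((1 : G) * · : G → G) = id := funext one_mul
  unfold mulInvariantVectorField
  rw [h, mfderiv_id]
  rfl

/-- Chain rule for the composite of left translations by `g` and then by `a`. -/
theorem mfderiv_mul_left_mulInvariantVectorField (X : GroupLieAlgebra (𝓡 d) G) (a g : G) :
    mfderiv (𝓡 d) (𝓡 d) (a * ·) g (mulInvariantVectorField X g) =
      mulInvariantVectorField X (a * g) := by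
  have h : ((a * g) * · : G → G) = (a * ·) ∘ (g * ·) := by ext x; simp [mul_assoc]
  have h1 : (mfderiv (𝓡 d) (𝓡 d) ((a * g) * · : G → G) 1 : Vec d →L[ℝ] Vec d) =
      (mfderiv (𝓡 d) (𝓡 d) (a * ·) (g * 1) : Vec d →L[ℝ] Vec d).comp
        (mfderiv (𝓡 d) (𝓡 d) (g * ·) 1 : Vec d →L[ℝ] Vec d) := by
    rw [h]
    exact mfderiv_comp (I' := 𝓡 d) 1 (mdifferentiableAt_mul_left a (g * 1))
      (mdifferentiableAt_mul_left g 1)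
  rw [mul_one g] at h1
  exact (DFunLike.congr_fun h1 (X : Vec d)).symm

theorem isMIntegralCurveOn_mul_left {X : GroupLieAlgebra (𝓡 d) G} {γ : ℝ → G} {s : Set ℝ}
    (hγ : IsMIntegralCurveOn γ (mulInvariantVectorField X) s) (a : G) :
    IsMIntegralCurveOn (fun t => a * γ t) (mulInvariantVectorField X) s := by
  intro t ht
  have := (mdifferentiableAt_mul_left a (γ t)).hasMFDerivAt.comp_hasMFDerivWithinAt t (hγ t ht)
  refine this.congr_mfderiv ?_
  ext
  change mfderiv (𝓡 d) (𝓡 d) (a * ·) (γ t) ((1 : ℝ) • mulInvariantVectorField X (γ t)) =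
    (1 : ℝ) • mulInvariantVectorField X (a * γ t)
  rw [one_smul, one_smul, mfderiv_mul_left_mulInvariantVectorField]

/-- Left translates of one local integral curve through `1` give integral curves through every point
with the same lifetime `ε`; this uniformity forces completeness. -/
theorem exists_isMIntegralCurve_mulInvariantVectorField [T2Space G]
    (X : GroupLieAlgebra (𝓡 d) G) :
    ∃ φ : ℝ → G, φ 0 = 1 ∧ IsMIntegralCurve φ (mulInvariantVectorField X) := by
  have hv := (contMDiff_mulInvariantVectorField_infty X).of_le (n := ∞) (m := 1) (by simp)
  obtain ⟨γ, hγ0, hγ⟩ := exists_isMIntegralCurveAt_of_contMDiffAt_boundaryless 0 (hv 1)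
  obtain ⟨ε, hε, hγ⟩ := isMIntegralCurveAt_iff'.1 hγ
  rw [Real.ball_eq_Ioo, zero_sub, zero_add] at hγ
  exact exists_isMIntegralCurve_of_isMIntegralCurveOn hv hε
    (fun x => ⟨_, by simp [hγ0], isMIntegralCurveOn_mul_left hγ x⟩) 1

omit [LieGroup (𝓡 d) ∞ G] in
theorem IsOneParameterSubgroup.map_zero {φ : ℝ → G} {X : GroupLieAlgebra (𝓡 d) G}
    (hφ : IsOneParameterSubgroup φ X) : φ 0 = 1 := by
  simpa using hφ.map_add 0 0

omit [LieGroup (𝓡 d) ∞ G] in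
theorem IsOneParameterSubgroup.hasMFDerivAt_zero {φ : ℝ → G} {X : GroupLieAlgebra (𝓡 d) G}
    (hφ : IsOneParameterSubgroup φ X) :
    HasMFDerivAt 𝓘(ℝ, ℝ) (𝓡 d) φ 0
      ((1 : ℝ →L[ℝ] ℝ).smulRight (mulInvariantVectorField X (φ 0))) := by
  have h1 := ((hφ.smooth.mdifferentiable (by simp)) 0).hasMFDerivAt
  refine h1.congr_mfderiv ?_
  have h2 : (⟨φ 0, mfderiv 𝓘(ℝ, ℝ) (𝓡 d) φ 0 (1 : ℝ)⟩ : TangentBundle (𝓡 d) G) =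
    ⟨φ 0, mulInvariantVectorField X (φ 0)⟩ := by
    refine hφ.velocity_zero.trans ?_
    rw [hφ.map_zero, mulInvariantVectorField_one]
  have h3 : mfderiv 𝓘(ℝ, ℝ) (𝓡 d) φ 0 (1 : ℝ) = mulInvariantVectorField X (φ 0) :=
    eq_of_heq (TotalSpace.mk.inj h2).2
  ext
  change mfderiv 𝓘(ℝ, ℝ) (𝓡 d) φ 0 (1 : ℝ) = (1 : ℝ) • mulInvariantVectorField X (φ 0)
  rw [h3, one_smul]

/-- Since `φ r = φ t * φ (r - t)`, the derivative at `t` is the left translate of the derivative at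
`0`. -/
theorem IsOneParameterSubgroup.isMIntegralCurve {φ : ℝ → G} {X : GroupLieAlgebra (𝓡 d) G}
    (hφ : IsOneParameterSubgroup φ X) :
    IsMIntegralCurve φ (mulInvariantVectorField X) := by
  intro t
  have h2 : HasMFDerivAt 𝓘(ℝ, ℝ) (𝓡 d) (fun s => φ t * φ s) 0
      ((1 : ℝ →L[ℝ] ℝ).smulRight (mulInvariantVectorField X (φ t * φ 0))) := by
    have := (mdifferentiableAt_mul_left (φ t) (φ 0)).hasMFDerivAt.comp 0 hφ.hasMFDerivAt_zero
    refine this.congr_mfderiv ?_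
    ext
    change mfderiv (𝓡 d) (𝓡 d) (φ t * ·) (φ 0) ((1 : ℝ) • mulInvariantVectorField X (φ 0)) =
      (1 : ℝ) • mulInvariantVectorField X (φ t * φ 0)
    rw [one_smul, one_smul, mfderiv_mul_left_mulInvariantVectorField]
  have h3 : HasMFDerivAt 𝓘(ℝ, ℝ) 𝓘(ℝ, ℝ) (fun s : ℝ => s - t) t (ContinuousLinearMap.id ℝ ℝ) :=
    ((hasFDerivAt_id t).sub_const t).hasMFDerivAt
  -- The base point `0` must appear as the value of `s ↦ s - t` at `t` for the chain rule.
  rw [← sub_self t] at h2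
  have h4 := HasMFDerivAt.comp (f := fun s : ℝ => s - t) t h2 h3
  have h5 : (fun s => φ t * φ s) ∘ (fun s : ℝ => s - t) = φ := by
    ext s
    simp [← hφ.map_add]
  have h6 : φ t * φ (t - t) = φ t := congrFun h5 t
  rw [h5, h6] at h4
  exact h4

variable [T2Space G]

theorem eq_of_isMIntegralCurve_mulInvariantVectorField {X : GroupLieAlgebra (𝓡 d) G}
    {γ γ' : ℝ → G} (hγ : IsMIntegralCurve γ (mulInvariantVectorField X))
    (hγ' : IsMIntegralCurve γ' (mulInvariantVectorField X)) {t₀ : ℝ} (h : γ t₀ = γ' t₀) :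
    γ = γ' :=
  isMIntegralCurve_Ioo_eq_of_contMDiff_boundaryless (t₀ := t₀)
    ((contMDiff_mulInvariantVectorField_infty X).of_le (n := ∞) (m := 1) (by simp)) hγ hγ' h

/-- Additivity is uniqueness: `φ (s + ·)` and `φ s * φ ·` are integral curves of the same field that
agree at `0`. -/
theorem isOneParameterSubgroup_of_isMIntegralCurve {X : GroupLieAlgebra (𝓡 d) G} {φ : ℝ → G}
    (hφ0 : φ 0 = 1) (hφ : IsMIntegralCurve φ (mulInvariantVectorField X)) :
    IsOneParameterSubgroup φ X where
  smooth := contMDiff_of_isMIntegralCurve (contMDiff_mulInvariantVectorField_infty X) hφ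
  map_add s t := by
    have h1 := hφ.comp_add s
    have h2 : IsMIntegralCurve (fun r => φ s * φ r) (mulInvariantVectorField X) :=
      isMIntegralCurve_iff_isMIntegralCurveOn.2
        (isMIntegralCurveOn_mul_left (hφ.isMIntegralCurveOn univ) (φ s))
    have := congrFun (eq_of_isMIntegralCurve_mulInvariantVectorField h1 h2 (t₀ := 0)
      (by simp [hφ0])) t
    simpa [add_comm] using this
  velocity_zero := by
    unfold velocity
    rw [(hφ 0).mfderiv, hφ0, mulInvariantVectorField_one]
    congr 1
    exact one_smul ℝ (X : Vec d)

theorem exists_isOneParameterSubgroup (X : GroupLieAlgebra (𝓡 d) G) :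
    ∃ φ : ℝ → G, IsOneParameterSubgroup φ X :=
  let ⟨φ, h0, h⟩ := exists_isMIntegralCurve_mulInvariantVectorField X
  ⟨φ, isOneParameterSubgroup_of_isMIntegralCurve h0 h⟩

/-- The subgroup chosen in `lieExp` and the rescaled curve `r ↦ φ (r * t)` are both integral curves
of the field of `t • X` starting at `1`. -/
theorem IsOneParameterSubgroup.lieExp_smul {φ : ℝ → G} {X : GroupLieAlgebra (𝓡 d) G}
    (hφ : IsOneParameterSubgroup φ X) (t : ℝ) : lieExp (t • X) = φ t := by
  have h : ∃ ψ : ℝ → G, IsOneParameterSubgroup ψ (t • X) := exists_isOneParameterSubgroup _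
  rw [lieExp, dif_pos h]
  have h1 := h.choose_spec.isMIntegralCurve
  have h2 := hφ.isMIntegralCurve.comp_mul t
  rw [← mulInvariantVectorField_smul] at h2
  have h3 := eq_of_isMIntegralCurve_mulInvariantVectorField h1 h2 (t₀ := 0)
    (by simp [hφ.map_zero, h.choose_spec.map_zero])
  simpa using congrFun h3 1

end OneParameterSubgroups

/-! ### Velocities under translation of time and under maps. -/

section Velocity

open Bundle Function Set Filter
open scoped Topology

variable {n : ℕ} {M : Type*} [TopologicalSpace M] [ChartedSpace (Vec n) M]

theorem velocity_congr {c c' : ℝ → M} {t : ℝ} (h : c =ᶠ[𝓝 t] c') :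
    velocity (n := n) c t = velocity c' t := by
  unfold velocity
  rw [h.mfderiv_eq, h.eq_of_nhds]

theorem velocity_comp_add {c : ℝ → M} {t s : ℝ}
    (hc : MDifferentiableAt 𝓘(ℝ, ℝ) (𝓡 n) c (s + t)) :
    velocity (n := n) (fun r => c (r + t)) s = velocity c (s + t) := by
  have h : HasMFDerivAt 𝓘(ℝ, ℝ) 𝓘(ℝ, ℝ) (fun r : ℝ => r + t) s (ContinuousLinearMap.id ℝ ℝ) :=
    ((hasFDerivAt_id s).add_const t).hasMFDerivAt
  have := HasMFDerivAt.comp (f := fun r : ℝ => r + t) s hc.hasMFDerivAt h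
  exact congrArg (fun A : ℝ →L[ℝ] Vec n => (⟨c (s + t), A 1⟩ : TangentBundle (𝓡 n) M))
    this.mfderiv

theorem velocity_comp {d : ℕ} {N : Type*} [TopologicalSpace N] [ChartedSpace (Vec d) N]
    {f : M → N} {c : ℝ → M} {t : ℝ}
    (hf : MDifferentiableAt (𝓡 n) (𝓡 d) f (c t)) (hc : MDifferentiableAt 𝓘(ℝ, ℝ) (𝓡 n) c t) :
    velocity (fun s => f (c s)) t = tangentMap (𝓡 n) (𝓡 d) f (velocity c t) :=
  congrArg (fun A : ℝ →L[ℝ] Vec d => (⟨f (c t), A 1⟩ : TangentBundle (𝓡 d) N))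
    (mfderiv_comp t hf hc)

theorem velocity_const (x : M) (t : ℝ) :
    velocity (fun _ => x) t = (⟨x, 0⟩ : TangentBundle (𝓡 n) M) := by
  unfold velocity
  rw [mfderiv_const]
  rfl

end Velocity

/-! ### Distortion under linear isometries. -/

section Distortion

variable {n : ℕ} {M : Type*} [TopologicalSpace M] [ChartedSpace (Vec n) M]

/-- No regularity of `q` is required: `fderiv` commutes with linear equivalences even where it takes
its default value. -/
theorem fderiv_fderiv_comp_continuousLinearEquiv {E : Type*} [NormedAddCommGroup E]
    [NormedSpace ℝ E] (q : E → ℝ) (A : E ≃L[ℝ] E) (y u w : E) :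
    fderiv ℝ (fderiv ℝ (fun z => q (A z))) y u w = fderiv ℝ (fderiv ℝ q) (A y) (A u) (A w) := by
  have h1 : fderiv ℝ (fun z => q (A z)) =
      (A.symm.arrowCongr (ContinuousLinearEquiv.refl ℝ ℝ)) ∘ (fderiv ℝ q ∘ A) := by
    ext z v
    rw [show (fun z => q (A z)) = q ∘ A from rfl, A.comp_right_fderiv]
    simp
  rw [h1, ContinuousLinearEquiv.comp_fderiv, A.comp_right_fderiv]
  simp

/-- The distortion is invariant under linear isomorphisms of tangent spaces that preserve `F`. -/
theorem distortion_eq_of_isometry (F : TangentBundle (𝓡 n) M → ℝ) {x x' : M}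
    (A : TangentSpace (𝓡 n) x ≃L[ℝ] TangentSpace (𝓡 n) x')
    (hA : ∀ y, F ⟨x', A y⟩ = F ⟨x, y⟩) (y : TangentSpace (𝓡 n) x) :
    distortion F ⟨x', A y⟩ = distortion F ⟨x, y⟩ := by
  -- In the image under `A` of the basis at `x`, both the Gram matrix and the coordinate unit ball
  -- become literally those at `x`.
  rw [distortion_eq_distortionIn F ⟨x', A y⟩ ((coordBasis x).map A.toLinearEquiv)]
  unfold distortion distortionIn
  congr 2
  · congr 2
    ext i j
    simp only [Matrix.of_apply, fundamentalTensor]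
    congr 1
    have := fderiv_fderiv_comp_continuousLinearEquiv (E := Vec n) (fun z => F ⟨x', z⟩ ^ 2) A y
      (coordBasis x i) (coordBasis x j)
    have hq : (fun z : Vec n => F ⟨x', A z⟩ ^ 2) = fun z : Vec n => F ⟨x, z⟩ ^ 2 :=
      funext fun z => congrArg (· ^ 2) (hA z)
    exact this.symm.trans (congrArg (fun q : Vec n → ℝ =>
      fderiv ℝ (fderiv ℝ q) y (coordBasis x i) (coordBasis x j)) hq)
  · unfold busemannDensity
    congr 3
    ext y
    have h : ∑ i, y i • (coordBasis x).map A.toLinearEquiv i =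
        A (∑ i, y i • coordBasis (n := n) x i) := by
      simp [map_sum]
    simp only [h, hA]

end Distortion

/-! ### The group action and invariance of the distortion. -/

section Invariance

variable {n d : ℕ} {G : Type*} [TopologicalSpace G] [ChartedSpace (Vec d) G] [Group G]
  {M : Type*} [TopologicalSpace M] [ChartedSpace (Vec n) M]
  [MulAction G M] [ContMDiffSMul (𝓡 d) (𝓡 n) ∞ G M]

include d in
theorem contMDiff_smul_left (a : G) : ContMDiff (𝓡 n) (𝓡 n) ∞ (fun q : M => a • q) :=
  (contMDiff_smul (I := 𝓡 d) (I' := 𝓡 n) (n := ∞) (G := G) (M := M)).comp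
    (contMDiff_const.prodMk contMDiff_id)

theorem contMDiff_smul_right (p : M) : ContMDiff (𝓡 d) (𝓡 n) ∞ (fun a : G => a • p) :=
  (contMDiff_smul (I := 𝓡 d) (I' := 𝓡 n) (n := ∞) (G := G) (M := M)).comp
    (contMDiff_id.prodMk contMDiff_const)

/-- The diffeomorphism of `M` given by the action of a group element. -/
def smulDiffeomorph (d : ℕ) {G : Type*} [TopologicalSpace G] [ChartedSpace (Vec d) G] [Group G]
    [MulAction G M] [ContMDiffSMul (𝓡 d) (𝓡 n) ∞ G M] (a : G) :
    Diffeomorph (𝓡 n) (𝓡 n) M M ∞ where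
  toEquiv := MulAction.toPerm a
  contMDiff_toFun := contMDiff_smul_left (d := d) a
  contMDiff_invFun := contMDiff_smul_left (d := d) a⁻¹

include d in
theorem IsInvariant.distortion_tangentMap {F : TangentBundle (𝓡 n) M → ℝ}
    (hF : IsInvariant G F) (a : G) (v : TangentBundle (𝓡 n) M) :
    distortion F (tangentMap (𝓡 n) (𝓡 n) (fun q : M => a • q) v) = distortion F v := by
  let A : TangentSpace (𝓡 n) v.proj ≃L[ℝ] TangentSpace (𝓡 n) (a • v.proj) :=
    (smulDiffeomorph d a).mfderivToContinuousLinearEquiv (by simp) v.proj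
  have hA : ∀ y, A y = mfderiv (𝓡 n) (𝓡 n) (fun q : M => a • q) v.proj y := fun y => rfl
  have h := distortion_eq_of_isometry F A (fun y => by rw [hA]; exact hF a ⟨v.proj, y⟩) v.snd
  rw [hA] at h
  exact h

end Invariance

/-! ### Smoothness of the Chern coefficients in coordinates. -/

section LocalCoefficients

open Filter
open scoped Topology

variable {n : ℕ} {f L : Vec n × Vec n → ℝ} {z : Vec n × Vec n}

theorem contDiffAt_dX (k : Fin n) (hf : ContDiffAt ℝ ∞ f z) : ContDiffAt ℝ ∞ (dX k f) z :=
  (hf.fderiv_right (m := ∞) le_rfl).clm_apply contDiffAt_const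

theorem contDiffAt_dY (k : Fin n) (hf : ContDiffAt ℝ ∞ f z) : ContDiffAt ℝ ∞ (dY k f) z :=
  (hf.fderiv_right (m := ∞) le_rfl).clm_apply contDiffAt_const

theorem contDiffAt_gLow (hL : ContDiffAt ℝ ∞ L z) (i j : Fin n) :
    ContDiffAt ℝ ∞ (gLow L i j) z :=
  contDiffAt_dY i (contDiffAt_dY j (contDiffAt_const.mul (hL.pow 2)))

theorem contDiffAt_det {ι : Type*} [Fintype ι] [DecidableEq ι] {E : Type*}
    [NormedAddCommGroup E] [NormedSpace ℝ E] {A : E → Matrix ι ι ℝ} {x : E}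
    (hA : ∀ i j, ContDiffAt ℝ ∞ (fun y => A y i j) x) :
    ContDiffAt ℝ ∞ (fun y => (A y).det) x := by
  simp only [Matrix.det_apply]
  exact ContDiffAt.sum fun σ _ => (contDiffAt_prod fun i _ => hA _ _).const_smul _

/-- Cramer's rule: the entries of the inverse are quotients of determinants. -/
theorem contDiffAt_matrix_inv {ι : Type*} [Fintype ι] [DecidableEq ι] {E : Type*}
    [NormedAddCommGroup E] [NormedSpace ℝ E] {A : E → Matrix ι ι ℝ} {x : E}
    (hA : ∀ i j, ContDiffAt ℝ ∞ (fun y => A y i j) x) (hdet : (A x).det ≠ 0) (i j : ι) :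
    ContDiffAt ℝ ∞ (fun y => (A y)⁻¹ i j) x := by
  simp only [Matrix.inv_def, Matrix.smul_apply, Ring.inverse_eq_inv, smul_eq_mul,
    Matrix.adjugate_apply]
  refine ((contDiffAt_det hA).inv hdet).mul (contDiffAt_det fun k l => ?_)
  by_cases hk : k = j
  · subst hk
    simp only [Matrix.updateRow_self]
    exact contDiffAt_const
  · simp only [Matrix.updateRow_ne hk]
    exact hA k l

theorem contDiffAt_gInv (hL : ContDiffAt ℝ ∞ L z)
    (hdet : (Matrix.of fun a b => gLow L a b z).det ≠ 0) (i j : Fin n) :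
    ContDiffAt ℝ ∞ (gInv L i j) z :=
  contDiffAt_matrix_inv (A := fun z => Matrix.of fun a b => gLow L a b z)
    (fun a b => contDiffAt_gLow hL a b) hdet i j

theorem contDiffAt_snd_apply (k : Fin n) : ContDiffAt ℝ ∞ (fun z : Vec n × Vec n => z.2 k) z :=
  (contDiffAt_euclidean.1 contDiffAt_snd) k

variable (hL : ContDiffAt ℝ ∞ L z) (hdet : (Matrix.of fun a b => gLow L a b z).det ≠ 0)
include hL hdet

theorem contDiffAt_formalChristoffel (i j k : Fin n) :
    ContDiffAt ℝ ∞ (formalChristoffel L i j k) z :=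
  contDiffAt_const.mul <| ContDiffAt.sum fun s _ => (contDiffAt_gInv hL hdet i s).mul <|
    ((contDiffAt_dX k (contDiffAt_gLow hL s j)).sub
      (contDiffAt_dX s (contDiffAt_gLow hL j k))).add (contDiffAt_dX j (contDiffAt_gLow hL k s))

theorem contDiffAt_cartanUp (i j k : Fin n) : ContDiffAt ℝ ∞ (cartanUp L i j k) z :=
  contDiffAt_const.mul <| ContDiffAt.sum fun s _ => (contDiffAt_gInv hL hdet i s).mul <|
    contDiffAt_dY k (contDiffAt_gLow hL s j)

theorem contDiffAt_nonlinearConn (i j : Fin n) : ContDiffAt ℝ ∞ (nonlinearConn L i j) z :=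
  (ContDiffAt.sum fun k _ => (contDiffAt_formalChristoffel hL hdet i j k).mul
      (contDiffAt_snd_apply k)).sub <|
    ContDiffAt.sum fun k _ => (contDiffAt_cartanUp hL hdet i j k).mul <|
      ContDiffAt.sum fun r _ => ContDiffAt.sum fun s _ =>
        ((contDiffAt_formalChristoffel hL hdet k r s).mul (contDiffAt_snd_apply r)).mul
          (contDiffAt_snd_apply s)

theorem contDiffAt_dHor (k : Fin n) (hf : ContDiffAt ℝ ∞ f z) :
    ContDiffAt ℝ ∞ (dHor L k f) z :=
  (contDiffAt_dX k hf).sub <| ContDiffAt.sum fun s _ =>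
    (contDiffAt_nonlinearConn hL hdet s k).mul (contDiffAt_dY s hf)

theorem contDiffAt_chernCoeff (i j k : Fin n) : ContDiffAt ℝ ∞ (chernCoeff L i j k) z :=
  contDiffAt_const.mul <| ContDiffAt.sum fun s _ => (contDiffAt_gInv hL hdet i s).mul <|
    ((contDiffAt_dHor hL hdet k (contDiffAt_gLow hL s j)).sub
      (contDiffAt_dHor hL hdet s (contDiffAt_gLow hL j k))).add
      (contDiffAt_dHor hL hdet j (contDiffAt_gLow hL k s))

omit hdet in
include hL in
/-- `gLow` is the Hessian of `½ L²` in the fibre direction. -/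
theorem gLow_eq_fderiv_fderiv (i j : Fin n) :
    gLow L i j z =
      (1 / 2 : ℝ) * fderiv ℝ (fderiv ℝ fun y => L (z.1, y) ^ 2) z.2 (stdVec i) (stdVec j) := by
  set K : Vec n × Vec n → ℝ := fun w => (1 / 2 : ℝ) * L w ^ 2 with hKdef
  have hK : ContDiffAt ℝ ∞ K z := contDiffAt_const.mul (hL.pow 2)
  have hι : ∀ y, HasFDerivAt (fun y : Vec n => (z.1, y))
      (ContinuousLinearMap.inr ℝ (Vec n) (Vec n)) y :=
    fun y => hasFDerivAt_prodMk_right z.1 y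
  have hs : ContDiffAt ℝ ∞ (fun y : Vec n => L (z.1, y) ^ 2) z.2 :=
    ContDiffAt.comp z.2 (g := fun w => L w ^ 2) (hL.pow 2) (contDiffAt_const.prodMk contDiffAt_id)
  have hev : ∀ᶠ w in 𝓝 z, DifferentiableAt ℝ K w :=
    ((hK.of_le (m := 1) (by simp)).eventually (by simp)).mono fun w hw =>
      hw.differentiableAt (by simp)
  have hcont : Tendsto (fun y : Vec n => (z.1, y)) (𝓝 z.2) (𝓝 z) :=
     (Continuous.prodMk_right z.1).tendsto z.2
  have hevs : ∀ᶠ y in 𝓝 z.2, DifferentiableAt ℝ (fun y : Vec n => L (z.1, y) ^ 2) y :=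
    ((hs.of_le (m := 1) (by simp)).eventually (by simp)).mono fun w hw =>
      hw.differentiableAt (by simp)
  -- Equality is needed on a neighbourhood of `z.2`, because both sides are differentiated once
  -- more.
  have h1 : (fun y => dY j K (z.1, y)) =ᶠ[𝓝 z.2]
      fun y => (1 / 2 : ℝ) * fderiv ℝ (fun y => L (z.1, y) ^ 2) y (stdVec j) := by
    filter_upwards [hcont.eventually hev, hevs] with y hy hy'
    have h2 := HasFDerivAt.comp (f := fun y : Vec n => (z.1, y)) y hy.hasFDerivAt (hι y)
    have h3 := h2.unique (hy'.hasFDerivAt.const_smul (1 / 2 : ℝ))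
    simpa [dY] using DFunLike.congr_fun h3 (stdVec j)
  have h4 := HasFDerivAt.comp (g := dY j K) (f := fun y : Vec n => (z.1, y)) z.2
    ((contDiffAt_dY j hK).differentiableAt (by simp)).hasFDerivAt (hι z.2)
  have h5 : DifferentiableAt ℝ (fderiv ℝ fun y => L (z.1, y) ^ 2) z.2 :=
    (hs.fderiv_right (m := ∞) le_rfl).differentiableAt (by simp)
  have h6 := (((h5.hasFDerivAt.clm_apply (hasFDerivAt_const (stdVec j) z.2)).const_smul
    (1 / 2 : ℝ)).congr_of_eventuallyEq h1)
  simpa [gLow, dY, hKdef] using DFunLike.congr_fun (h4.unique h6) (stdVec i)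

end LocalCoefficients

/-! ### The Finsler function in the chart centred at a point. -/

section LocalExpression

open Filter Bundle
open scoped Topology

variable {n : ℕ} {M : Type*} [TopologicalSpace M] [ChartedSpace (Vec n) M]
  [IsManifold (𝓡 n) ∞ M]

theorem extChartAt_tangent_apply_self (x : M) (y : TangentSpace (𝓡 n) x) :
    extChartAt (𝓡 n).tangent (⟨x, 0⟩ : TangentBundle (𝓡 n) M) ⟨x, y⟩ =
      (extChartAt (𝓡 n) x x, y) :=
  Prod.ext rfl (tangentCoordChange_self (mem_extChartAt_source (I := 𝓡 n) x))

theorem extChartAt_tangent_source_self (x : M) (y : TangentSpace (𝓡 n) x) :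
    (⟨x, y⟩ : TangentBundle (𝓡 n) M) ∈
      (extChartAt (𝓡 n).tangent (⟨x, 0⟩ : TangentBundle (𝓡 n) M)).source := by
  rw [extChartAt_source, TangentBundle.mem_chart_source_iff]
  exact mem_chart_source _ x

theorem extChartAt_tangent_symm_self (x : M) (y : TangentSpace (𝓡 n) x) :
    (extChartAt (𝓡 n).tangent (⟨x, 0⟩ : TangentBundle (𝓡 n) M)).symm (extChartAt (𝓡 n) x x, y) =
      ⟨x, y⟩ :=
  (congrArg (extChartAt (𝓡 n).tangent (⟨x, 0⟩ : TangentBundle (𝓡 n) M)).symm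
    (extChartAt_tangent_apply_self x y).symm).trans
    (PartialEquiv.left_inv _ (extChartAt_tangent_source_self x y))

theorem localExpr_self (F : TangentBundle (𝓡 n) M → ℝ) (x : M) (y : TangentSpace (𝓡 n) x) :
    localExpr F x (extChartAt (𝓡 n) x x, y) = F ⟨x, y⟩ :=
  congrArg F (extChartAt_tangent_symm_self x y)

theorem FinslerMetric.map_zero (F : FinslerMetric n M) (x : M) : F.toFun ⟨x, 0⟩ = 0 := by
  simpa using F.map_smul x 0 0 le_rfl

theorem FinslerMetric.snd_ne_zero (F : FinslerMetric n M) {v : TangentBundle (𝓡 n) M}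
    (hv : F.toFun v ≠ 0) : v.snd ≠ 0 := by
  obtain ⟨x, y⟩ := v
  rintro (rfl : y = 0)
  exact hv (F.map_zero x)

/-- `F` is continuous and vanishes on the zero section, so `F ≠ 0` cuts out an open set of nonzero
vectors. -/
theorem FinslerMetric.contMDiffAt (F : FinslerMetric n M) {v : TangentBundle (𝓡 n) M}
    (hv : F.toFun v ≠ 0) : ContMDiffAt (𝓡 n).tangent 𝓘(ℝ, ℝ) ∞ F.toFun v := by
  have hU : {w | F.toFun w ≠ 0} ∈ 𝓝 v := (isOpen_ne_fun F.continuous continuous_const).mem_nhds hv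
  exact F.contMDiffOn.contMDiffAt (mem_of_superset hU fun w hw => F.snd_ne_zero hw)

theorem FinslerMetric.contDiffAt_localExpr (F : FinslerMetric n M) {x : M}
    {y : TangentSpace (𝓡 n) x} (hy : F.toFun ⟨x, y⟩ ≠ 0) :
    ContDiffAt ℝ ∞ (localExpr F.toFun x) (extChartAt (𝓡 n) x x, y) := by
  have hmem : (extChartAt (𝓡 n) x x, y) ∈
      (extChartAt (𝓡 n).tangent (⟨x, 0⟩ : TangentBundle (𝓡 n) M)).target := by
    rw [← extChartAt_tangent_apply_self]
    exact PartialEquiv.map_source _ (extChartAt_tangent_source_self x y)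
  have h1 : ContMDiffAt 𝓘(ℝ, Vec n × Vec n) (𝓡 n).tangent ∞
      (extChartAt (𝓡 n).tangent (⟨x, 0⟩ : TangentBundle (𝓡 n) M)).symm
      (extChartAt (𝓡 n) x x, y) :=
    (contMDiffOn_extChartAt_symm _).contMDiffAt (extChartAt_target_mem_nhds' hmem)
  have h2 : ContMDiffAt (𝓡 n).tangent 𝓘(ℝ, ℝ) ∞ F.toFun
      ((extChartAt (𝓡 n).tangent (⟨x, 0⟩ : TangentBundle (𝓡 n) M)).symm
        (extChartAt (𝓡 n) x x, y)) := by
    rw [extChartAt_tangent_symm_self]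
    exact F.contMDiffAt hy
  exact (h2.comp _ h1).contDiffAt

/-- A null vector of the matrix would be the coordinates of some `u ≠ 0` with `g_y(u, u) = 0`. -/
theorem FinslerMetric.det_gLow_ne_zero (F : FinslerMetric n M) {x : M}
    {y : TangentSpace (𝓡 n) x} (hy : F.toFun ⟨x, y⟩ ≠ 0) :
    (Matrix.of fun i j => gLow (localExpr F.toFun x) i j (extChartAt (𝓡 n) x x, y)).det ≠ 0 := by
  set B : Vec n →L[ℝ] Vec n →L[ℝ] ℝ :=
    fderiv ℝ (fderiv ℝ fun y : Vec n => F.toFun ⟨x, y⟩ ^ 2) y with hB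
  have hg : ∀ i j, gLow (localExpr F.toFun x) i j (extChartAt (𝓡 n) x x, y) =
      (1 / 2 : ℝ) * B (stdVec i) (stdVec j) := by
    intro i j
    rw [gLow_eq_fderiv_fderiv (F.contDiffAt_localExpr hy)]
    have : (fun w : Vec n => localExpr F.toFun x (extChartAt (𝓡 n) x x, w) ^ 2) =
        fun w : Vec n => F.toFun ⟨x, w⟩ ^ 2 :=
      funext fun w => congrArg (· ^ 2) (localExpr_self F.toFun x w)
    rw [hB, ← this]
  intro hdet
  obtain ⟨a, ha, hMa⟩ := Matrix.exists_mulVec_eq_zero_iff.2 hdet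
  let u : Vec n := ∑ i, a i • stdVec i
  have hua : ∀ i, u i = a i := fun i => by
    simp [u, stdVec, Pi.single_apply]
  have hu : u ≠ 0 := fun h => ha (funext fun i => by rw [← hua, h]; rfl)
  have hpos : 0 < (1 / 2 : ℝ) * B u u := F.pos_def ⟨x, y⟩ (F.snd_ne_zero hy) u hu
  have hzero : (1 / 2 : ℝ) * B u u = 0 := by
    have h1 : ∀ i, ∑ j, (1 / 2 : ℝ) * B (stdVec i) (stdVec j) * a j = 0 := fun i => by
      have := congrFun hMa i
      simp only [Matrix.mulVec, dotProduct, Matrix.of_apply, hg, Pi.zero_apply] at this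
      exact this
    have h2 : ∀ w : Vec n, B w u = ∑ j, B w (stdVec j) * a j := fun w => by
      simp [u, map_sum, mul_comm]
    have h3 : B u u = ∑ i, a i * B (stdVec i) u := by
      conv_lhs => enter [1]; simp only [u, map_sum, map_smul]
      simp
    rw [h3, Finset.mul_sum]
    refine Finset.sum_eq_zero fun i _ => ?_
    have h4 : (1 / 2 : ℝ) * B (stdVec i) u = 0 := by
      rw [h2, Finset.mul_sum, ← h1 i]
      exact Finset.sum_congr rfl fun j _ => by ring
    rw [mul_left_comm, h4, mul_zero]
  exact hpos.ne' hzero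

end LocalExpression

/-! ### Local uniqueness of geodesics. -/

section GeodesicUniqueness

open Filter Bundle
open scoped Topology

variable {n : ℕ} {M : Type*} [TopologicalSpace M] [ChartedSpace (Vec n) M]
  [IsManifold (𝓡 n) ∞ M]

/-- The geodesic spray in local coordinates. -/
def localSpray (L : Vec n × Vec n → ℝ) (z : Vec n × Vec n) : Vec n × Vec n :=
  (z.2, WithLp.toLp 2 fun i => -∑ j, ∑ k, z.2 j * z.2 k * chernCoeff L i j k z)

theorem contDiffAt_localSpray {L : Vec n × Vec n → ℝ} {z : Vec n × Vec n}
    (hL : ContDiffAt ℝ ∞ L z) (hdet : (Matrix.of fun a b => gLow L a b z).det ≠ 0) :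
    ContDiffAt ℝ ∞ (localSpray L) z := by
  refine contDiffAt_snd.prodMk (contDiffAt_euclidean.2 fun i => ?_)
  exact ContDiffAt.neg <| ContDiffAt.sum fun j _ => ContDiffAt.sum fun k _ =>
    ((contDiffAt_snd_apply j).mul (contDiffAt_snd_apply k)).mul
      (contDiffAt_chernCoeff hL hdet i j k)

-- `mfderiv` is computed in the preferred chart at the point, so no coordinate change enters when
-- the chart is centred at `c t`.
omit [IsManifold (𝓡 n) ∞ M] in
theorem deriv_extChartAt_comp {c : ℝ → M} {t : ℝ}
    (hc : MDifferentiableAt 𝓘(ℝ, ℝ) (𝓡 n) c t) :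
    deriv (fun s => extChartAt (𝓡 n) (c t) (c s)) t = (velocity (n := n) c t).snd := by
  unfold velocity
  simp only [mfderiv, hc]
  simp [writtenInExtChartAt, Function.comp_def]
  rfl

theorem IsGeodesicOn.eventually_contDiffAt {F : TangentBundle (𝓡 n) M → ℝ} {c : ℝ → M} {ε : ℝ}
    (hε : 0 < ε) (hc : IsGeodesicOn F c (Set.Ioo (-ε) ε)) :
    ∀ᶠ t in 𝓝 0, t ∈ Set.Ioo (-ε) ε ∧ c t ∈ (extChartAt (𝓡 n) (c 0)).source ∧
      ContDiffAt ℝ ∞ (fun s => extChartAt (𝓡 n) (c 0) (c s)) t := by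
  have h0 : Set.Ioo (-ε) ε ∈ 𝓝 (0 : ℝ) := Ioo_mem_nhds (neg_lt_zero.2 hε) hε
  have hat : ∀ t ∈ Set.Ioo (-ε) ε, ContMDiffAt 𝓘(ℝ, ℝ) (𝓡 n) ∞ c t := fun t ht =>
    hc.smooth.contMDiffAt (isOpen_Ioo.mem_nhds ht)
  filter_upwards [h0, (hat 0 (mem_of_mem_nhds h0)).continuousAt
    (extChartAt_source_mem_nhds (I := 𝓡 n) (c 0))] with t ht hsrc
  refine ⟨ht, hsrc, ?_⟩
  have h1 : ContMDiffAt (𝓡 n) 𝓘(ℝ, Vec n) ∞ (extChartAt (𝓡 n) (c 0)) (c t) :=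
    contMDiffAt_extChartAt' (by rwa [← extChartAt_source (𝓡 n)])
  exact (h1.comp t (hat t ht)).contDiffAt

/-- In the chart at `c 0`, the lift `(c, ċ)` of a geodesic is an integral curve of the spray. -/
theorem IsGeodesicOn.eventually_hasDerivAt {F : TangentBundle (𝓡 n) M → ℝ} {c : ℝ → M} {ε : ℝ}
    (hε : 0 < ε) (hc : IsGeodesicOn F c (Set.Ioo (-ε) ε)) :
    ∀ᶠ t in 𝓝 0, HasDerivAt
      (fun s => (extChartAt (𝓡 n) (c 0) (c s),
        deriv (fun r => extChartAt (𝓡 n) (c 0) (c r)) s))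
      (localSpray (localExpr F (c 0)) (extChartAt (𝓡 n) (c 0) (c t),
        deriv (fun r => extChartAt (𝓡 n) (c 0) (c r)) t)) t := by
  filter_upwards [hc.eventually_contDiffAt hε] with t ⟨ht, hsrc, hsm⟩
  have h2 : DifferentiableAt ℝ (deriv fun r => extChartAt (𝓡 n) (c 0) (c r)) t :=
    ((hsm.fderiv_right (m := ∞) le_rfl).clm_apply contDiffAt_const).differentiableAt (by simp)
  have h3 := (hsm.differentiableAt (by simp)).hasDerivAt.prodMk h2.hasDerivAt
  convert! h3 using 1
  refine Prod.ext rfl ?_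
  ext i
  have := hc.equation t ht (c 0) hsrc i
  exact (eq_neg_of_add_eq_zero_left this).symm

/-- Two geodesics with the same initial velocity agree near the initial time. -/
theorem FinslerMetric.geodesic_eventuallyEq (F : FinslerMetric n M) {c c' : ℝ → M} {ε ε' : ℝ}
    (hε : 0 < ε) (hε' : 0 < ε') (hc : IsGeodesicOn F.toFun c (Set.Ioo (-ε) ε))
    (hc' : IsGeodesicOn F.toFun c' (Set.Ioo (-ε') ε'))
    (h : velocity (n := n) c 0 = velocity c' 0) : c =ᶠ[𝓝 0] c' := by
  have h0 : c 0 = c' 0 := congrArg TotalSpace.proj h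
  have hmd : ∀ {γ : ℝ → M} {δ : ℝ}, 0 < δ → IsGeodesicOn F.toFun γ (Set.Ioo (-δ) δ) →
      MDifferentiableAt 𝓘(ℝ, ℝ) (𝓡 n) γ 0 := fun hδ hγ =>
    (hγ.smooth.contMDiffAt (Ioo_mem_nhds (neg_lt_zero.2 hδ) hδ)).mdifferentiableAt (by simp)
  have hd := deriv_extChartAt_comp (hmd hε hc)
  have hd' := deriv_extChartAt_comp (hmd hε' hc')
  have hdd : deriv (fun s => extChartAt (𝓡 n) (c 0) (c s)) 0 =
      deriv (fun s => extChartAt (𝓡 n) (c 0) (c' s)) 0 := by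
    have hsnd : ∀ v w : TangentBundle (𝓡 n) M, v = w → (v.snd : Vec n) = w.snd := by
      rintro v _ rfl
      rfl
    have hd'' : deriv (fun s => extChartAt (𝓡 n) (c 0) (c' s)) 0 =
        (velocity (n := n) c' 0).snd := by
      rw [h0]
      exact hd'
    exact hd.trans ((hsnd _ _ h).trans hd''.symm)
  obtain ⟨κ, hκ, hspeed⟩ := hc.speed
  -- Positive speed keeps the initial vector off the zero section, where the spray is smooth.
  have hF : F.toFun ⟨c 0, (velocity (n := n) c 0).snd⟩ ≠ 0 := by
    have := hspeed 0 ⟨neg_lt_zero.2 hε, hε⟩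
    exact (this.trans_gt hκ).ne'
  have hspray : ContDiffAt ℝ 1 (localSpray (localExpr F.toFun (c 0)))
      (extChartAt (𝓡 n) (c 0) (c 0), deriv (fun s => extChartAt (𝓡 n) (c 0) (c s)) 0) := by
    rw [hd]
    exact (contDiffAt_localSpray (F.contDiffAt_localExpr hF) (F.det_gLow_ne_zero hF)).of_le
      (by simp)
  obtain ⟨K, s, hs, hlip⟩ := hspray.exists_lipschitzOnWith
  have hη := hc.eventually_hasDerivAt hε
  have hη' := hc'.eventually_hasDerivAt hε'
  have hsrc' := hc'.eventually_contDiffAt hε'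
  rw [← h0] at hη' hsrc'
  -- The spray is Lipschitz on a neighbourhood `s` of the common initial value, and by continuity
  -- both lifts stay in `s` for small times.
  have heq := ODE_solution_unique_of_eventually (t₀ := 0)
    (v := fun _ => localSpray (localExpr F.toFun (c 0))) (s := fun _ => s)
    (.of_forall fun _ => hlip)
    (hη.and (hη.self_of_nhds.continuousAt hs))
    (hη'.and (hη'.self_of_nhds.continuousAt (by
      simp only [← h0, ← hdd]
      exact hs)))
    (Prod.ext (by simp only [h0]) hdd)
  filter_upwards [heq, hc.eventually_contDiffAt hε, hsrc'] with t h1 h2 h3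
  exact (extChartAt (𝓡 n) (c 0)).injOn h2.2.1 h3.2.1 (congrArg Prod.fst h1)

/-- If the distortion is constant along a geodesic then the S-curvature vanishes there. -/
theorem FinslerMetric.hasSCurvature_zero (F : FinslerMetric n M) {c : ℝ → M} {ε : ℝ}
    (hε : 0 < ε) (hc : IsGeodesicOn F.toFun c (Set.Ioo (-ε) ε))
    (hτ : ∀ t, distortion F.toFun (velocity c t) = distortion F.toFun (velocity c 0)) :
    HasSCurvature F.toFun (velocity c 0) 0 := by
  refine ⟨⟨c, ε, hε, hc, rfl⟩, fun c' ε' hε' hc' hv => ?_⟩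
  refine (hasDerivAt_const (0 : ℝ) (distortion F.toFun (velocity c 0))).congr_of_eventuallyEq ?_
  -- The curves must agree near each such `t`, not only at `t`, for their velocities to agree.
  filter_upwards [(F.geodesic_eventuallyEq hε' hε hc' hc hv).eventually_nhds] with t ht
  rw [velocity_congr ht, hτ]

end GeodesicUniqueness

/-! ### Translation of the parameter of a geodesic. -/

section GeodesicShift

variable {n : ℕ} {M : Type*} [TopologicalSpace M] [ChartedSpace (Vec n) M]
  [IsManifold (𝓡 n) ∞ M]

theorem IsGeodesicOn.mdifferentiable {F : TangentBundle (𝓡 n) M → ℝ} {c : ℝ → M}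
    (hc : IsGeodesicOn F c Set.univ) : MDifferentiable 𝓘(ℝ, ℝ) (𝓡 n) c :=
  (contMDiffOn_univ.1 hc.smooth).mdifferentiable (by simp)

/-- Translating the parameter of a geodesic defined on `ℝ` gives a geodesic. -/
theorem IsGeodesicOn.comp_add {F : TangentBundle (𝓡 n) M → ℝ} {c : ℝ → M}
    (hc : IsGeodesicOn F c Set.univ) (t : ℝ) (J : Set ℝ) :
    IsGeodesicOn F (fun s => c (s + t)) J where
  smooth := by
    have h : ContMDiff 𝓘(ℝ, ℝ) 𝓘(ℝ, ℝ) ∞ fun s : ℝ => s + t :=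
      (contDiff_id.add contDiff_const).contMDiff
    exact ((contMDiffOn_univ.1 hc.smooth).comp h).contMDiffOn
  speed := by
    obtain ⟨κ, hκ, h⟩ := hc.speed
    refine ⟨κ, hκ, fun s _ => ?_⟩
    rw [velocity_comp_add (hc.mdifferentiable _)]
    exact h _ (Set.mem_univ _)
  equation := by
    intro s _ x₀ hx₀ i
    have h := hc.equation (s + t) (Set.mem_univ _) x₀ hx₀ i
    have h1 : deriv (fun r => extChartAt (𝓡 n) x₀ (c (r + t))) =
        fun r => deriv (fun r => extChartAt (𝓡 n) x₀ (c r)) (r + t) :=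
      funext fun r => deriv_comp_add_const (fun r => extChartAt (𝓡 n) x₀ (c r)) t r
    simp only [h1, deriv_comp_add_const]
    exact h

end GeodesicShift

/-! ### Orbits of one-parameter subgroups. -/

section Orbits

variable {n d : ℕ} {M : Type*} [TopologicalSpace M]
  {G : Type*} [TopologicalSpace G] [T2Space G] [ChartedSpace (Vec d) G] [Group G]
  [LieGroup (𝓡 d) ∞ G] [MulAction G M]

omit [TopologicalSpace M] in
theorem orbitCurve_add (p : M) (X : GroupLieAlgebra (𝓡 d) G) (s t : ℝ) :
    orbitCurve p X (s + t) = lieExp (t • X) • orbitCurve p X s := by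
  obtain ⟨φ, hφ⟩ := exists_isOneParameterSubgroup X
  simp only [orbitCurve, hφ.lieExp_smul]
  rw [add_comm, hφ.map_add, mul_smul]

variable [ChartedSpace (Vec n) M] [ContMDiffSMul (𝓡 d) (𝓡 n) ∞ G M]

theorem velocity_orbitCurve_zero (p : M) (X : GroupLieAlgebra (𝓡 d) G) :
    velocity (n := n) (orbitCurve p X) 0 = orbitTangent p X := by
  obtain ⟨φ, hφ⟩ := exists_isOneParameterSubgroup X
  have h : orbitCurve p X = fun t => φ t • p :=
    funext fun t => by rw [orbitCurve, hφ.lieExp_smul]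
  rw [h, velocity_comp (f := fun a : G => a • p)
    ((contMDiff_smul_right (d := d) p).mdifferentiable (by simp) _)
    (hφ.smooth.mdifferentiable (by simp) 0), hφ.velocity_zero]
  rfl

/-- The orbit of `p` is constant, so its initial velocity vanishes. -/
theorem mfderiv_smul_eq_zero_of_fixes {p : M} {Y : GroupLieAlgebra (𝓡 d) G}
    (hY : ∀ t : ℝ, lieExp (t • Y) ∈ MulAction.stabilizer G p) :
    mfderiv (𝓡 d) (𝓡 n) (fun a : G => a • p) 1 Y = 0 := by
  have h1 : orbitCurve p Y = fun _ => p := funext fun t => hY t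
  have h2 := velocity_orbitCurve_zero (n := n) p Y
  rw [h1, velocity_const] at h2
  -- The base points `1 • p` and `p` are not syntactically equal, so the fibre components are
  -- compared in `Vec n`.
  have h3 : ∀ v w : TangentBundle (𝓡 n) M, v = w → (v.snd : Vec n) = w.snd := by
    rintro v _ rfl
    rfl
  exact (h3 _ _ h2).symm

/-- The fundamental vector field at `p` only depends on the component in a complement of the
isotropy algebra. -/
theorem IsReductiveDecomposition.orbitTangent_projection {p : M}
    {m h : Submodule ℝ (GroupLieAlgebra (𝓡 d) G)} (hmh : IsReductiveDecomposition p m h)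
    (X : GroupLieAlgebra (𝓡 d) G) :
    orbitTangent (n := n) p (m.projection h hmh.isCompl X) = orbitTangent p X := by
  have hmem : X - m.projection h hmh.isCompl X ∈ h :=
    Submodule.sub_projection_mem hmh.isCompl X
  have h0 := mfderiv_smul_eq_zero_of_fixes (n := n) ((hmh.mem_isotropy _).1 hmem)
  rw [map_sub, sub_eq_zero] at h0
  unfold orbitTangent tangentMap
  exact congrArg (fun y : Vec n => (⟨(1 : G) • p, y⟩ : TangentBundle (𝓡 n) M)) h0.symm

variable [IsManifold (𝓡 n) ∞ M]

/-- Differentiate `orbitCurve_add` in `s` at `0`. -/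
theorem velocity_orbitCurve {F : TangentBundle (𝓡 n) M → ℝ} {p : M}
    {X : GroupLieAlgebra (𝓡 d) G} (hX : IsGeodesicVector F p X) (t : ℝ) :
    velocity (n := n) (orbitCurve p X) t =
      tangentMap (𝓡 n) (𝓡 n) (fun q : M => lieExp (t • X) • q)
        (velocity (orbitCurve p X) 0) := by
  have hmd := hX.2.mdifferentiable
  rw [← velocity_comp ((contMDiff_smul_left (d := d) _).mdifferentiable (by simp) _) (hmd 0)]
  have h := velocity_comp_add (t := t) (s := 0) (hmd _)
  rw [zero_add] at h
  rw [← h]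
  exact congrArg (fun c : ℝ → M => velocity c 0) (funext fun s => orbitCurve_add p X s t)

end Orbits


end Finsler

end

theorem theorem5p1 {n d : ℕ}
    {M : Type*} [TopologicalSpace M] [T2Space M] [ChartedSpace (Finsler.Vec n) M]
    [IsManifold (𝓡 n) ∞ M]
    {G : Type*} [TopologicalSpace G] [T2Space G] [ChartedSpace (Finsler.Vec d) G] [Group G]
    [LieGroup (𝓡 d) ∞ G]
    [MulAction G M] [ContMDiffSMul (𝓡 d) (𝓡 n) ∞ G M] [MulAction.IsPretransitive G M]
    (F : Finsler.FinslerMetric n M) (hF : Finsler.IsInvariant G F.toFun) (p : M)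
    (X : GroupLieAlgebra (𝓡 d) G) (hX : Finsler.IsGeodesicVector F.toFun p X) :
    (∀ (m h : Submodule ℝ (GroupLieAlgebra (𝓡 d) G))
        (hmh : Finsler.IsReductiveDecomposition p m h),
        Finsler.HasSCurvature F.toFun
          (Finsler.orbitTangent p (m.projection h hmh.isCompl X)) 0) ∧
      ∀ t : ℝ,
        Finsler.distortion F.toFun (Finsler.velocity (Finsler.orbitCurve p X) t) =
            Finsler.distortion F.toFun (Finsler.velocity (Finsler.orbitCurve p X) 0) ∧
          Finsler.HasSCurvature F.toFun (Finsler.velocity (Finsler.orbitCurve p X) t) 0 := by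
  have hτ : ∀ t : ℝ, Finsler.distortion F.toFun (Finsler.velocity (Finsler.orbitCurve p X) t) =
      Finsler.distortion F.toFun (Finsler.velocity (Finsler.orbitCurve p X) 0) := fun t => by
    rw [Finsler.velocity_orbitCurve hX t]
    exact hF.distortion_tangentMap (d := d) _ _
  have hS : ∀ t : ℝ,
      Finsler.HasSCurvature F.toFun (Finsler.velocity (Finsler.orbitCurve p X) t) 0 := fun t => by
    have hv : ∀ s, Finsler.velocity (n := n) (fun r => Finsler.orbitCurve p X (r + t)) s =
        Finsler.velocity (Finsler.orbitCurve p X) (s + t) := fun s =>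
      Finsler.velocity_comp_add (hX.2.mdifferentiable _)
    -- `HasSCurvature` refers to geodesics based at time `0`, so `γ` is shifted by `t`.
    have h := F.hasSCurvature_zero one_pos (hX.2.comp_add t _) fun s => by
      rw [hv, hv, hτ, hτ (0 + t)]
    rwa [hv, zero_add] at h
  refine ⟨fun m h hmh => ?_, fun t => ⟨hτ t, hS t⟩⟩
  -- The vector induced by `X_𝔪` is the initial velocity of `γ`, which reduces the claim to time
  -- `0`.
  rw [hmh.orbitTangent_projection, ← Finsler.velocity_orbitCurve_zero]
  exact hS 0
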